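/- Let $n \ge k \ge 2$ be integers. The game NecklaceNim $NN(n,k)$ is played on $n$ stacks of tokens placed on the vertices $1,\dots,n$ of a path; a position is a vector $p=(p_1,\dots,p_n)$ of nonnegative integers. A move consists of choosing one of the sets $\{i,i+1,\dots,i+k-1\}$ with $1\le i\le n-k+1$, or the set $\{1,n\}$, and removing tokens from the stacks in the chosen set, at least one token in total (and possibly none from some of its stacks). Two players alternate, and the last player to move wins. A $\mathcal P$-position is a position from which the player who has just moved (the previous player) has a winning strategy; equivalently, a position none of whose options is a $\mathcal P$-position. Let $n\ge 3$, $\ell=\lfloor n/2\rfloor$ and $k=\lceil n/2\rceil$; that is, consider the games $NN(2\ell,\ell)$ with $\ell\ge 2$ and $NN(2\ell+1,\ell+1)$ with $\ell\ge 1$. For $2\le i\le \ell+1$ put $s_i=p_i+p_{i+1}+\dots+p_{i+k-2}$. Then the set of $\mathcal P$-positions of $NN(n,k)$ is $$\Bigl\{p \;\Bigm|\; p_1+\dots+p_{\lfloor n/2\rfloor}=p_{\lceil n/2\rceil+1}+\dots+p_n \ \text{ and }\ \min(p_1,p_n)=\min_{2\le i\le \ell+1} s_i\Bigr\}.$$ 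-/

import Mathlib

/-- A position of a game on `n` stacks of tokens arranged on a path. The stacks
`p_1, …, p_n` are `p 0, …, p (n - 1)`: the vertex `v : Fin n` carries the label `v + 1`. -/
abbrev Position (n : ℕ) : Type := Fin n → ℕ

/-- A legal move of the game SetNim with collection `𝒜` of move sets: choose a set `A ∈ 𝒜` and
remove, in total, at least one token from the stacks in `A`, leaving all other stacks unchanged. -/
def SetNimMove {n : ℕ} (𝒜 : Set (Finset (Fin n))) (p q : Position n) : Prop :=
  ∃ A ∈ 𝒜, (∀ v, q v ≤ p v) ∧ (∀ v, v ∉ A → q v = p v) ∧ ∃ v, q v < p v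

theorem SetNimMove.sum_lt {n : ℕ} {𝒜 : Set (Finset (Fin n))} {p q : Position n}
    (h : SetNimMove 𝒜 p q) : ∑ v, q v < ∑ v, p v := by
  obtain ⟨A, _, hle, _, v, hv⟩ := h
  exact Finset.sum_lt_sum (fun w _ => hle w) ⟨v, Finset.mem_univ v, hv⟩

/-- The 𝒫-positions of SetNim under normal play (the last player to move wins): a position is
a 𝒫-position if and only if none of its options is a 𝒫-position. The recursion is well-founded
because each move lowers the total number of tokens. -/
def IsPPosition {n : ℕ} (𝒜 : Set (Finset (Fin n))) (p : Position n) : Prop :=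
  ∀ q : Position n, SetNimMove 𝒜 p q → ¬ IsPPosition 𝒜 q
termination_by ∑ v, p v
decreasing_by exact SetNimMove.sum_lt (by assumption)

/-- The set of vertices with labels `a, a + 1, …, b`. -/
def pathSegment (n a b : ℕ) : Finset (Fin n) :=
  Finset.univ.filter fun v => a ≤ (v : ℕ) + 1 ∧ (v : ℕ) + 1 ≤ b

/-- The set consisting of the two end vertices, labelled `1` and `n`. -/
def endVertices (n : ℕ) : Finset (Fin n) :=
  Finset.univ.filter fun v => (v : ℕ) + 1 = 1 ∨ (v : ℕ) + 1 = n

/-- The move sets of NecklaceNim `NN(n, k)`: the sets `{i, …, i + k - 1}` of `k` consecutive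
vertices, `i = 1, …, n - k + 1`, and the set `{1, n}`. -/
def necklaceNim (n k : ℕ) : Set (Finset (Fin n)) :=
  {A | ∃ i : ℕ, 1 ≤ i ∧ i + k ≤ n + 1 ∧ A = pathSegment n i (i + k - 1)} ∪ {endVertices n}

/-- The sum `p_a + p_{a+1} + … + p_b`. -/
def segmentSum {n : ℕ} (p : Position n) (a b : ℕ) : ℕ :=
  ∑ v ∈ pathSegment n a b, p v

/-- The first end stack `p_1`. -/
def firstStack {n : ℕ} (hn : 3 ≤ n) (p : Position n) : ℕ := p ⟨0, by omega⟩

/-- The last end stack `p_n`. -/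
def lastStack {n : ℕ} (hn : 3 ≤ n) (p : Position n) : ℕ := p ⟨n - 1, by omega⟩

theorem windowIndices_nonempty {n ℓ : ℕ} (hn : 3 ≤ n) (hℓ : ℓ = n / 2) :
    (Finset.Icc 2 (ℓ + 1)).Nonempty := by
  rw [Finset.nonempty_Icc]
  omega

/-! Cut the path into a left half `a 1, …, a ℓ`, a right half `b 1, …, b ℓ` and a middle of `c`
tokens (empty for even `n`). A segment move with parameter `s` touches the `a x` with `x > s`, the
middle, and the `b y` with `y ≤ s`. The window with parameter `t` consists of the `a x` with `x >
t`, the middle, and the `b y` with `y < t`, so it never contains the end stacks `a 1` and `b ℓ`.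

No move joins two balanced positions. A segment move between them takes equally much from both
halves and keeps both ends, hence also the least window sum; but a least window contains all that
the move can reach in one of the halves, so nothing is taken (`BalancedHalves.eq_of_segmentMove`).
An end move keeps all windows while lowering both ends equally (`BalancedHalves.eq_of_endMove`).

Conversely, let the left half exceed the right by `δ`; the other case follows by reflection. Trim
`δ` tokens from the left half, starting next to the middle. If the windows are still large enough,
paired removals around the point where tail sums of `a` cross head sums of `b` lower the least
window to the end minimum (`exists_segmentMove_windows_min`). Otherwise take the `δ` tokens from `a
1` first. If the windows are now large enough, shifting tokens one by one between the two
arrangements meets a balanced one, up to a correction of one token (`exists_balanced_between`). If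
not, only `a 1` was touched, and lowering both ends further is an end move to a balanced position.
-/

open Finset

/-! ### Partial sums of the left and right halves -/

/-- The sum of `a x` over `t < x ≤ ℓ`. -/
def tailSum (ℓ : ℕ) (a : ℕ → ℕ) (t : ℕ) : ℕ := ∑ x ∈ Ioc t ℓ, a x

/-- The sum of `b y` over `1 ≤ y ≤ t`. -/
def headSum (b : ℕ → ℕ) (t : ℕ) : ℕ := ∑ y ∈ Ioc 0 t, b y

/-- Decrease the value of `f` at `x` by one. -/
def decAt (f : ℕ → ℕ) (x : ℕ) : ℕ → ℕ := Function.update f x (f x - 1)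

/-- Increase the value of `f` at `x` by one. -/
def incAt (f : ℕ → ℕ) (x : ℕ) : ℕ → ℕ := Function.update f x (f x + 1)

theorem decAt_self (f : ℕ → ℕ) (x : ℕ) : decAt f x x = f x - 1 := by simp [decAt]

theorem decAt_of_ne (f : ℕ → ℕ) {x z : ℕ} (h : z ≠ x) : decAt f x z = f z := by simp [decAt, h]

theorem incAt_self (f : ℕ → ℕ) (x : ℕ) : incAt f x x = f x + 1 := by simp [incAt]

theorem incAt_of_ne (f : ℕ → ℕ) {x z : ℕ} (h : z ≠ x) : incAt f x z = f z := by simp [incAt, h]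

theorem decAt_le (f : ℕ → ℕ) (x z : ℕ) : decAt f x z ≤ f z := by
  by_cases h : z = x
  · subst h; rw [decAt_self]; omega
  · rw [decAt_of_ne f h]

theorem sum_decAt_of_mem {s : Finset ℕ} {f : ℕ → ℕ} {x : ℕ} (hx : x ∈ s) (hf : 0 < f x) :
    ∑ z ∈ s, decAt f x z + 1 = ∑ z ∈ s, f z := by
  rw [decAt, sum_update_of_mem hx, ← add_sum_erase s f hx, sdiff_singleton_eq_erase]
  omega

theorem sum_decAt_of_notMem {s : Finset ℕ} {f : ℕ → ℕ} {x : ℕ} (hx : x ∉ s) :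
    ∑ z ∈ s, decAt f x z = ∑ z ∈ s, f z := by
  rw [decAt, sum_update_of_notMem hx]

theorem sum_incAt_of_mem {s : Finset ℕ} {f : ℕ → ℕ} {x : ℕ} (hx : x ∈ s) :
    ∑ z ∈ s, incAt f x z = ∑ z ∈ s, f z + 1 := by
  rw [incAt, sum_update_of_mem hx, ← add_sum_erase s f hx, sdiff_singleton_eq_erase]
  omega

theorem sum_incAt_of_notMem {s : Finset ℕ} {f : ℕ → ℕ} {x : ℕ} (hx : x ∉ s) :
    ∑ z ∈ s, incAt f x z = ∑ z ∈ s, f z := by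
  rw [incAt, sum_update_of_notMem hx]

section Sums

variable {ℓ t x : ℕ} {a b : ℕ → ℕ}

theorem tailSum_decAt (h : t < x) (hx : x ≤ ℓ) (ha : 0 < a x) :
    tailSum ℓ (decAt a x) t + 1 = tailSum ℓ a t :=
  sum_decAt_of_mem (mem_Ioc.2 ⟨h, hx⟩) ha

theorem tailSum_decAt_of_le (h : x ≤ t) : tailSum ℓ (decAt a x) t = tailSum ℓ a t :=
  sum_decAt_of_notMem (by simp; omega)

theorem tailSum_incAt (h : t < x) (hx : x ≤ ℓ) :
    tailSum ℓ (incAt a x) t = tailSum ℓ a t + 1 :=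
  sum_incAt_of_mem (mem_Ioc.2 ⟨h, hx⟩)

theorem tailSum_incAt_of_le (h : x ≤ t) : tailSum ℓ (incAt a x) t = tailSum ℓ a t :=
  sum_incAt_of_notMem (by simp; omega)

theorem headSum_decAt (h : 0 < x) (hx : x ≤ t) (hb : 0 < b x) :
    headSum (decAt b x) t + 1 = headSum b t :=
  sum_decAt_of_mem (mem_Ioc.2 ⟨h, hx⟩) hb

theorem headSum_decAt_of_lt (h : t < x) : headSum (decAt b x) t = headSum b t :=
  sum_decAt_of_notMem (by simp; omega)

theorem tailSum_eq_add (h : t < ℓ) : tailSum ℓ a t = a (t + 1) + tailSum ℓ a (t + 1) := by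
  unfold tailSum
  rw [← sum_Ioc_consecutive a (Nat.le_succ t) h]
  simp

theorem tailSum_self (ℓ : ℕ) (a : ℕ → ℕ) : tailSum ℓ a ℓ = 0 := by simp [tailSum]

theorem headSum_zero (b : ℕ → ℕ) : headSum b 0 = 0 := by simp [headSum]

theorem headSum_eq_add (h : 0 < t) : headSum b t = headSum b (t - 1) + b t := by
  obtain ⟨s, rfl⟩ : ∃ s, t = s + 1 := ⟨t - 1, by omega⟩
  unfold headSum
  rw [← sum_Ioc_consecutive b (Nat.zero_le s) (Nat.le_succ s)]
  simp

theorem tailSum_anti {s : ℕ} (h : s ≤ t) : tailSum ℓ a t ≤ tailSum ℓ a s :=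
  sum_le_sum_of_subset (Ioc_subset_Ioc_left h)

theorem headSum_mono {s : ℕ} (h : s ≤ t) : headSum b s ≤ headSum b t :=
  sum_le_sum_of_subset (Ioc_subset_Ioc_right h)

theorem tailSum_congr {a' : ℕ → ℕ} (h : ∀ x, t < x → x ≤ ℓ → a' x = a x) :
    tailSum ℓ a' t = tailSum ℓ a t :=
  sum_congr rfl fun x hx => h x (mem_Ioc.1 hx).1 (mem_Ioc.1 hx).2

theorem headSum_congr {b' : ℕ → ℕ} (h : ∀ y, 0 < y → y ≤ t → b' y = b y) :
    headSum b' t = headSum b t :=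
  sum_congr rfl fun x hx => h x (mem_Ioc.1 hx).1 (mem_Ioc.1 hx).2

theorem tailSum_eq_of_zero {s : ℕ} (h : s ≤ t) (ht : t ≤ ℓ)
    (hz : ∀ z, s < z → z ≤ t → a z = 0) : tailSum ℓ a t = tailSum ℓ a s := by
  unfold tailSum
  rw [← sum_Ioc_consecutive a h ht, sum_eq_zero (s := Ioc s t), zero_add]
  intro z hmem
  exact hz z (mem_Ioc.1 hmem).1 (mem_Ioc.1 hmem).2

/-- If a tail sum is positive, there is a first positive entry in that tail. -/
theorem exists_first_pos (h : 0 < tailSum ℓ a t) :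
    ∃ x, t < x ∧ x ≤ ℓ ∧ 0 < a x ∧ ∀ z, t < z → z < x → a z = 0 := by
  classical
  have hex : ∃ x, t < x ∧ x ≤ ℓ ∧ 0 < a x := by
    by_contra! hc
    have : tailSum ℓ a t = 0 := sum_eq_zero fun x hx => by
      have := hc x (mem_Ioc.1 hx).1 (mem_Ioc.1 hx).2
      omega
    omega
  refine ⟨Nat.find hex, (Nat.find_spec hex).1, (Nat.find_spec hex).2.1, (Nat.find_spec hex).2.2, ?_⟩
  intro z hz hzx
  by_contra hne
  have := (Nat.find_spec hex).2.1
  exact Nat.find_min hex hzx ⟨hz, by omega, by omega⟩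

theorem exists_pos_of_headSum_pos (h : 0 < headSum b t) : ∃ y, 0 < y ∧ y ≤ t ∧ 0 < b y := by
  obtain ⟨y, h1, h2, h3, _⟩ := exists_first_pos (ℓ := t) (a := b) (t := 0) h
  exact ⟨y, h1, h2, h3⟩

end Sums

/-- Removing `δ` tokens from the tail, beginning at the far end. -/
def trimEnd (ℓ : ℕ) (a : ℕ → ℕ) (δ x : ℕ) : ℕ :=
  (tailSum ℓ a (x - 1) - δ) - (tailSum ℓ a x - δ)

theorem trimEnd_le {ℓ δ x : ℕ} (a : ℕ → ℕ) (h : 0 < x) (hx : x ≤ ℓ) : trimEnd ℓ a δ x ≤ a x := by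
  have := tailSum_eq_add (ℓ := ℓ) (t := x - 1) (a := a) (by omega)
  rw [Nat.sub_add_cancel h] at this
  unfold trimEnd
  omega

/-- If tokens survive beyond `t`, the trimming has stopped before reaching the stacks up to `t`.
This makes trimming part of a segment move with parameter `t`. -/
theorem trimEnd_eq {ℓ δ x t : ℕ} {a : ℕ → ℕ} (h : 0 < x) (hx : x ≤ t) (ht : t ≤ ℓ)
    (hδ : 0 < tailSum ℓ a t - δ) : trimEnd ℓ a δ x = a x := by
  have := tailSum_eq_add (ℓ := ℓ) (t := x - 1) (a := a) (by omega)
  rw [Nat.sub_add_cancel h] at this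
  have := tailSum_anti (ℓ := ℓ) (a := a) hx
  unfold trimEnd
  omega

theorem tailSum_trimEnd {ℓ δ t : ℕ} (a : ℕ → ℕ) (ht : t ≤ ℓ) :
    tailSum ℓ (trimEnd ℓ a δ) t = tailSum ℓ a t - δ := by
  induction ht using Nat.decreasingInduction with
  | self => simp [tailSum_self]
  | of_succ s hs ih =>
    rw [tailSum_eq_add (by omega), ih, trimEnd]
    have := tailSum_anti (ℓ := ℓ) (a := a) (Nat.le_succ s)
    simp only [Nat.add_sub_cancel, Nat.succ_eq_add_one] at *
    omega

/-! ### Windows -/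

/-- Every window sum of the position with left half `a`, middle `c` and right half `b` is at
least `m`. -/
def WindowsGE (ℓ : ℕ) (a b : ℕ → ℕ) (c m : ℕ) : Prop :=
  ∀ t, 1 ≤ t → t ≤ ℓ → m ≤ c + tailSum ℓ a t + headSum b (t - 1)

theorem WindowsGE.mono {ℓ c m m' : ℕ} {a b : ℕ → ℕ} (h : WindowsGE ℓ a b c m) (hm : m' ≤ m) :
    WindowsGE ℓ a b c m' := fun t h1 h2 => hm.trans (h t h1 h2)

theorem WindowsGE.congr {ℓ c m : ℕ} {a b a' b' : ℕ → ℕ} (h : WindowsGE ℓ a b c m)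
    (ha : ∀ x, 2 ≤ x → x ≤ ℓ → a' x = a x) (hb : ∀ y, 1 ≤ y → y < ℓ → b' y = b y) :
    WindowsGE ℓ a' b' c m := fun t h1 h2 => by
  rw [tailSum_congr fun x hx hx' => ha x (by omega) hx',
    headSum_congr fun y hy hy' => hb y hy (by omega)]
  exact h t h1 h2

theorem exists_window_min {ℓ : ℕ} (hℓ : 1 ≤ ℓ) (a b : ℕ → ℕ) (c : ℕ) :
    ∃ m, WindowsGE ℓ a b c m ∧ ¬ WindowsGE ℓ a b c (m + 1) := by
  by_contra! hc
  have hall : ∀ m, WindowsGE ℓ a b c m := fun m => by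
    induction m with
    | zero => exact fun t _ _ => Nat.zero_le _
    | succ m ih => exact hc m ih
  have := hall (c + tailSum ℓ a 1 + headSum b (1 - 1) + 1) 1 le_rfl hℓ
  omega

/-- The move `(a, b, c) → (a', b', c')` takes tokens only from the left stacks after `s`, the
middle, and the right stacks up to `s`. -/
structure SegmentMove (ℓ s : ℕ) (a b : ℕ → ℕ) (c : ℕ) (a' b' : ℕ → ℕ) (c' : ℕ) : Prop where
  left_le : ∀ x, 1 ≤ x → x ≤ ℓ → a' x ≤ a x
  right_le : ∀ y, 1 ≤ y → y ≤ ℓ → b' y ≤ b y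
  mid_le : c' ≤ c
  left_eq : ∀ x, 1 ≤ x → x ≤ s → x ≤ ℓ → a' x = a x
  right_eq : ∀ y, s < y → y ≤ ℓ → b' y = b y

/-- The move `(a, b, c) → (a', b', c')` takes tokens only from the two end stacks. -/
structure EndMove (ℓ : ℕ) (a b : ℕ → ℕ) (c : ℕ) (a' b' : ℕ → ℕ) (c' : ℕ) : Prop where
  left_le : a' 1 ≤ a 1
  right_le : b' ℓ ≤ b ℓ
  mid_eq : c' = c
  left_eq : ∀ x, 2 ≤ x → x ≤ ℓ → a' x = a x
  right_eq : ∀ y, 1 ≤ y → y < ℓ → b' y = b y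

theorem SegmentMove.trans {ℓ s : ℕ} {a b a' b' a'' b'' : ℕ → ℕ} {c c' c'' : ℕ}
    (h : SegmentMove ℓ s a b c a' b' c') (h' : SegmentMove ℓ s a' b' c' a'' b'' c'') :
    SegmentMove ℓ s a b c a'' b'' c'' where
  left_le x h1 h2 := (h'.left_le x h1 h2).trans (h.left_le x h1 h2)
  right_le x h1 h2 := (h'.right_le x h1 h2).trans (h.right_le x h1 h2)
  mid_le := h'.mid_le.trans h.mid_le
  left_eq x h1 h2 h3 := (h'.left_eq x h1 h2 h3).trans (h.left_eq x h1 h2 h3)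
  right_eq x h1 h2 := (h'.right_eq x h1 h2).trans (h.right_eq x h1 h2)

theorem SegmentMove.refl (ℓ s : ℕ) (a b : ℕ → ℕ) (c : ℕ) : SegmentMove ℓ s a b c a b c :=
  ⟨fun _ _ _ => le_rfl, fun _ _ _ => le_rfl, le_rfl, fun _ _ _ _ => rfl, fun _ _ _ => rfl⟩

/-- The description of the 𝒫-positions in terms of the two halves and the middle. -/
structure BalancedHalves (ℓ : ℕ) (a b : ℕ → ℕ) (c : ℕ) : Prop where
  sum_eq : tailSum ℓ a 0 = headSum b ℓ
  ge : WindowsGE ℓ a b c (min (a 1) (b ℓ))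
  not_ge : ¬ WindowsGE ℓ a b c (min (a 1) (b ℓ) + 1)

/-! ### No move connects two balanced positions -/

theorem BalancedHalves.eq_of_segmentMove {ℓ s : ℕ} (hℓ : 1 ≤ ℓ) (hs : s ≤ ℓ) {a b a' b' : ℕ → ℕ}
    {c c' : ℕ} (hp : BalancedHalves ℓ a b c) (hq : BalancedHalves ℓ a' b' c')
    (h : SegmentMove ℓ s a b c a' b' c') :
    (∀ x, 1 ≤ x → x ≤ ℓ → a' x = a x) ∧ (∀ y, 1 ≤ y → y ≤ ℓ → b' y = b y) ∧ c' = c := by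
  have split : ∀ (f : ℕ → ℕ) {i j : ℕ}, i ≤ j → j ≤ ℓ →
      tailSum ℓ f i = ∑ z ∈ Ioc i j, f z + tailSum ℓ f j := fun f i j h1 h2 =>
    (sum_Ioc_consecutive f h1 h2).symm
  have split' : ∀ (f : ℕ → ℕ) {i j : ℕ}, i ≤ j →
      headSum f j = headSum f i + ∑ z ∈ Ioc i j, f z := fun f i j h1 =>
    (sum_Ioc_consecutive f (Nat.zero_le i) h1).symm
  have hle : ∀ i j, j ≤ ℓ → ∑ z ∈ Ioc i j, a' z ≤ ∑ z ∈ Ioc i j, a z := fun i j hj =>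
    sum_le_sum fun z hz => h.left_le z (by have := mem_Ioc.1 hz; omega)
      (by have := mem_Ioc.1 hz; omega)
  have hle' : ∀ i j, j ≤ ℓ → ∑ z ∈ Ioc i j, b' z ≤ ∑ z ∈ Ioc i j, b z := fun i j hj =>
    sum_le_sum fun z hz => h.right_le z (by have := mem_Ioc.1 hz; omega)
      (by have := mem_Ioc.1 hz; omega)
  have e1 : ∑ z ∈ Ioc 0 s, a' z = ∑ z ∈ Ioc 0 s, a z := sum_congr rfl fun z hz => by
    have := mem_Ioc.1 hz
    exact h.left_eq z (by omega) (by omega) (by omega)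
  have e2 : ∑ z ∈ Ioc s ℓ, b' z = ∑ z ∈ Ioc s ℓ, b z := sum_congr rfl fun z hz => by
    have := mem_Ioc.1 hz
    exact h.right_eq z (by omega) (by omega)
  have hd : tailSum ℓ a s + headSum b' s = tailSum ℓ a' s + headSum b s := by
    have := hp.sum_eq; have := hq.sum_eq
    have := split a (Nat.zero_le s) hs; have := split a' (Nat.zero_le s) hs
    have := split' b hs; have := split' b' hs
    omega
  have hA : tailSum ℓ a' s ≤ tailSum ℓ a s := hle s ℓ le_rfl
  have hB : headSum b' s ≤ headSum b s := hle' 0 s hs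
  have heq : tailSum ℓ a' s = tailSum ℓ a s →
      (∀ x, 1 ≤ x → x ≤ ℓ → a' x = a x) ∧ (∀ y, 1 ≤ y → y ≤ ℓ → b' y = b y) := by
    intro hT
    have hT' : headSum b' s = headSum b s := by omega
    constructor
    · intro x h1 h2
      by_cases hx : x ≤ s
      · exact h.left_eq x h1 hx h2
      · refine (sum_eq_sum_iff_of_le fun z hz => ?_).1 hT x (mem_Ioc.2 ⟨by omega, h2⟩)
        have := mem_Ioc.1 hz
        exact h.left_le z (by omega) this.2
    · intro y h1 h2
      by_cases hy : s < y
      · exact h.right_eq y hy h2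
      · refine (sum_eq_sum_iff_of_le fun z hz => ?_).1 hT' y (mem_Ioc.2 ⟨by omega, by omega⟩)
        have := mem_Ioc.1 hz
        exact h.right_le z (by omega) (by omega)
  -- Only `s = 0` or `s = ℓ` gives access to an end stack, and then the other half is out of reach,
  -- so equal losses force both to be zero.
  have hends : a' 1 = a 1 ∧ b' ℓ = b ℓ := by
    by_cases h0 : s = 0
    · subst h0
      have := heq (by simpa [headSum_zero] using hd.symm)
      exact ⟨this.1 1 le_rfl hℓ, this.2 ℓ hℓ le_rfl⟩
    by_cases h1 : s = ℓ
    · subst h1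
      have := heq (by simp [tailSum_self])
      exact ⟨this.1 1 le_rfl hℓ, this.2 _ hℓ le_rfl⟩
    exact ⟨h.left_eq 1 le_rfl (by omega) hℓ, h.right_eq ℓ (by omega) le_rfl⟩
  have hn := hp.not_ge
  have hg := hq.ge
  rw [hends.1, hends.2] at hg
  unfold WindowsGE at hn
  push Not at hn
  obtain ⟨t, ht1, ht2, ht⟩ := hn
  have hgt := hg t ht1 ht2
  have hc := h.mid_le
  have h1 : tailSum ℓ a' t ≤ tailSum ℓ a t := hle t ℓ le_rfl
  have h2 : headSum b' (t - 1) ≤ headSum b (t - 1) := hle' 0 (t - 1) (by omega)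
  -- The least window `t` of the old position loses nothing. It contains all left stacks after `s`
  -- if `t ≤ s`, and all right stacks up to `s` otherwise.
  have hT : tailSum ℓ a' s = tailSum ℓ a s := by
    by_cases hts : t ≤ s
    · have := split a hts hs; have := split a' hts hs; have := hle t s hs
      omega
    · have := split' b (i := s) (j := t - 1) (by omega)
      have := split' b' (i := s) (j := t - 1) (by omega)
      have := hle' s (t - 1) (by omega)
      omega
  exact ⟨(heq hT).1, (heq hT).2, by omega⟩

theorem BalancedHalves.eq_of_endMove {ℓ : ℕ} (hℓ : 1 ≤ ℓ) {a b a' b' : ℕ → ℕ}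
    {c c' : ℕ} (hp : BalancedHalves ℓ a b c) (hq : BalancedHalves ℓ a' b' c')
    (h : EndMove ℓ a b c a' b' c') : a' 1 = a 1 ∧ b' ℓ = b ℓ := by
  have h1 := hp.sum_eq
  have h2 := hq.sum_eq
  rw [tailSum_eq_add (by omega), headSum_eq_add (by omega), zero_add] at h1 h2
  rw [tailSum_congr fun x hx hx' => h.left_eq x (by omega) hx',
    headSum_congr fun y hy hy' => h.right_eq y hy (by omega)] at h2
  have hl := h.left_le
  have hr := h.right_le
  by_contra hne
  apply hq.not_ge
  obtain rfl := h.mid_eq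
  exact (hp.ge.congr h.left_eq h.right_eq).mono (by omega)

/-! ### Reflection -/

/-- The reflection of the stacks `1, …, ℓ`. -/
def reflect (ℓ : ℕ) (f : ℕ → ℕ) (x : ℕ) : ℕ := f (ℓ + 1 - x)

theorem tailSum_reflect {ℓ t : ℕ} (f : ℕ → ℕ) (ht : t ≤ ℓ) :
    tailSum ℓ (reflect ℓ f) t = headSum f (ℓ - t) := by
  unfold tailSum headSum reflect
  refine sum_nbij' (fun x => ℓ + 1 - x) (fun x => ℓ + 1 - x) ?_ ?_ ?_ ?_ ?_ <;>
    intro x hx <;> simp only [mem_Ioc] at hx ⊢ <;> omega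

theorem headSum_reflect {ℓ t : ℕ} (f : ℕ → ℕ) (ht : t ≤ ℓ) :
    headSum (reflect ℓ f) t = tailSum ℓ f (ℓ - t) := by
  unfold tailSum headSum reflect
  refine sum_nbij' (fun x => ℓ + 1 - x) (fun x => ℓ + 1 - x) ?_ ?_ ?_ ?_ ?_ <;>
    intro x hx <;> simp only [mem_Ioc] at hx ⊢ <;> omega

theorem windowsGE_reflect {ℓ c m : ℕ} {a b : ℕ → ℕ} :
    WindowsGE ℓ (reflect ℓ b) (reflect ℓ a) c m ↔ WindowsGE ℓ a b c m := by
  constructor <;> intro h t h1 h2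
  · have := h (ℓ + 1 - t) (by omega) (by omega)
    rw [tailSum_reflect _ (by omega), headSum_reflect _ (by omega),
      show ℓ - (ℓ + 1 - t) = t - 1 by omega, show ℓ - (ℓ + 1 - t - 1) = t by omega] at this
    omega
  · have := h (ℓ + 1 - t) (by omega) (by omega)
    rw [tailSum_reflect _ (by omega), headSum_reflect _ (by omega),
      show ℓ - t = ℓ + 1 - t - 1 by omega, show ℓ - (t - 1) = ℓ + 1 - t by omega]
    omega

theorem SegmentMove.reflect {ℓ s c c' : ℕ} {a b a' b' : ℕ → ℕ}
    (h : SegmentMove ℓ s (reflect ℓ b) (reflect ℓ a) c a' b' c') (hs : s ≤ ℓ) :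
    SegmentMove ℓ (ℓ - s) a b c (reflect ℓ b') (reflect ℓ a') c' where
  left_le x h1 h2 := by
    have := h.right_le (ℓ + 1 - x) (by omega) (by omega)
    rwa [_root_.reflect, show ℓ + 1 - (ℓ + 1 - x) = x by omega] at this
  right_le x h1 h2 := by
    have := h.left_le (ℓ + 1 - x) (by omega) (by omega)
    rwa [_root_.reflect, show ℓ + 1 - (ℓ + 1 - x) = x by omega] at this
  mid_le := h.mid_le
  left_eq x h1 h2 h3 := by
    have := h.right_eq (ℓ + 1 - x) (by omega) (by omega)
    rwa [_root_.reflect, show ℓ + 1 - (ℓ + 1 - x) = x by omega] at this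
  right_eq x h1 h2 := by
    have := h.left_eq (ℓ + 1 - x) (by omega) (by omega) (by omega)
    rwa [_root_.reflect, show ℓ + 1 - (ℓ + 1 - x) = x by omega] at this

theorem EndMove.reflect {ℓ c c' : ℕ} {a b a' b' : ℕ → ℕ}
    (h : EndMove ℓ (reflect ℓ b) (reflect ℓ a) c a' b' c') :
    EndMove ℓ a b c (reflect ℓ b') (reflect ℓ a') c' where
  left_le := by
    simpa [_root_.reflect] using h.right_le
  right_le := by
    simpa [_root_.reflect] using h.left_le
  mid_eq := h.mid_eq
  left_eq x h1 h2 := by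
    have := h.right_eq (ℓ + 1 - x) (by omega) (by omega)
    rwa [_root_.reflect, show ℓ + 1 - (ℓ + 1 - x) = x by omega] at this
  right_eq x h1 h2 := by
    have := h.left_eq (ℓ + 1 - x) (by omega) (by omega)
    rwa [_root_.reflect, show ℓ + 1 - (ℓ + 1 - x) = x by omega] at this

theorem BalancedHalves.reflect {ℓ c : ℕ} {a b : ℕ → ℕ} (h : BalancedHalves ℓ a b c) :
    BalancedHalves ℓ (reflect ℓ b) (reflect ℓ a) c where
  sum_eq := by
    rw [tailSum_reflect _ (Nat.zero_le ℓ), headSum_reflect _ le_rfl, Nat.sub_self, Nat.sub_zero]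
    exact h.sum_eq.symm
  ge := by
    simpa [windowsGE_reflect, _root_.reflect, min_comm] using h.ge
  not_ge := by
    simpa [windowsGE_reflect, _root_.reflect, min_comm] using h.not_ge

/-! ### Lowering the smallest window sum without changing the end stacks -/

/-- If some window contains tokens of the middle stack only, the smallest window sum can be
lowered using the middle alone. -/
theorem windows_min_of_sum_eq_zero {ℓ t c m : ℕ} {a b : ℕ → ℕ} (h1 : 1 ≤ t) (h2 : t ≤ ℓ)
    (ha : tailSum ℓ a t = 0) (hb : headSum b (t - 1) = 0) (h : WindowsGE ℓ a b c m) :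
    m ≤ c ∧ WindowsGE ℓ a b m m ∧ ¬ WindowsGE ℓ a b m (m + 1) := by
  refine ⟨?_, fun s _ _ => by omega, fun hc => ?_⟩
  · have := h t h1 h2
    omega
  · have := hc t h1 h2
    omega

/-- Remove one token from each half at a time, so that the least window sum reaches `m` without
jumping over it. The inequalities on the sums are kept throughout; if the left tail runs out, window
`t` is the middle alone and `c` can be set to `m`. -/
theorem exists_segmentMove_windows_min {ℓ t c m : ℕ} (h1 : 1 ≤ t) (h2 : t ≤ ℓ) :
    ∀ {a b : ℕ → ℕ}, headSum b (t - 1) ≤ tailSum ℓ a t → tailSum ℓ a t ≤ headSum b t →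
      (0 < b t ∨ tailSum ℓ a t = 0) → WindowsGE ℓ a b c m →
      ∃ a' b' c', SegmentMove ℓ t a b c a' b' c' ∧ a' 1 = a 1 ∧ b' ℓ = b ℓ ∧
        tailSum ℓ a' 0 + headSum b ℓ = tailSum ℓ a 0 + headSum b' ℓ ∧
        WindowsGE ℓ a' b' c' m ∧ ¬ WindowsGE ℓ a' b' c' (m + 1) := by
  intro a
  induction hN : tailSum ℓ a t generalizing a with
  | zero =>
    intro b hb _ _ hW
    obtain ⟨hc, hW1, hW2⟩ := windows_min_of_sum_eq_zero h1 h2 hN (by omega) hW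
    exact ⟨a, b, m, ⟨fun _ _ _ => le_rfl, fun _ _ _ => le_rfl, hc, fun _ _ _ _ => rfl,
      fun _ _ _ => rfl⟩, rfl, rfl, rfl, hW1, hW2⟩
  | succ N ih =>
    intro b hb1 hb2 hbt hW
    by_cases hW' : WindowsGE ℓ a b c (m + 1)
    swap
    · exact ⟨a, b, c, SegmentMove.refl .., rfl, rfl, rfl, hW, hW'⟩
    replace hbt : 0 < b t := by omega
    obtain ⟨x, hx1, hx2, hx3, hx4⟩ := exists_first_pos (ℓ := ℓ) (a := a) (t := t) (by omega)
    have hta := tailSum_decAt hx1 hx2 hx3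
    have hta0 := tailSum_decAt (t := 0) (by omega) hx2 hx3
    have hbt_add := headSum_eq_add (b := b) (t := t) (by omega)
    have hba := headSum_decAt (b := b) (x := t) (t := t) (by omega) le_rfl hbt
    have hba0 := headSum_decAt (b := b) (x := t) (t := ℓ) (by omega) h2 hbt
    have hba1 := headSum_decAt_of_lt (b := b) (x := t) (t := t - 1) (by omega)
    have ha1 : decAt a x 1 = a 1 := decAt_of_ne a (by omega)
    -- Only windows `j` with `t < j < x` lose two tokens. There the left tail is still that of `t`,
    -- so they exceed window `t` by at least `b t > 0` and can afford the loss.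
    have hWA : WindowsGE ℓ (decAt a x) (decAt b t) c m := by
      intro j hj1 hj2
      have hj := hW' j hj1 hj2
      by_cases hjx : j < x
      · have e1 := tailSum_decAt hjx hx2 hx3
        by_cases hjt : j ≤ t
        · have e2 := headSum_decAt_of_lt (b := b) (x := t) (t := j - 1) (by omega)
          omega
        · have e2 := headSum_decAt (b := b) (x := t) (t := j - 1) (by omega) (by omega) hbt
          have e3 := tailSum_eq_of_zero (ℓ := ℓ) (a := a) (s := t) (t := j) (by omega) hj2
            fun z hz hz' => hx4 z hz (by omega)
          have e4 := headSum_mono (b := b) (s := t) (t := j - 1) (by omega)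
          have e5 := hW' t h1 h2
          omega
      · have e1 := tailSum_decAt_of_le (ℓ := ℓ) (a := a) (x := x) (t := j) (by omega)
        have e2 := headSum_decAt (b := b) (x := t) (t := j - 1) (by omega) (by omega) hbt
        omega
    have hA : SegmentMove ℓ t a b c (decAt a x) (decAt b t) c :=
      ⟨fun z _ _ => decAt_le a x z, fun z _ _ => decAt_le b t z, le_rfl,
        fun z _ _ _ => decAt_of_ne a (by omega), fun z _ _ => decAt_of_ne b (by omega)⟩
    -- Taking from `b t` again is harmless here. Otherwise it could break `headSum b (t - 1) ≤
    -- tailSum ℓ a t`, and a stack before `t` must be used instead.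
    by_cases hzero : headSum b (t - 1) = 0
    · have hself := decAt_self b t
      obtain ⟨a', b', c', hm, e1, e2, e3, e4, e5⟩ :=
        ih (a := decAt a x) (by omega) (b := decAt b t) (by omega) (by omega) (by omega) hWA
      refine ⟨a', b', c', hA.trans hm, e1.trans ha1, e2.trans (decAt_of_ne b ?_), by omega, e4, e5⟩
      omega
    by_cases hWA' : WindowsGE ℓ (decAt a x) (decAt b t) c (m + 1)
    swap
    · exact ⟨_, _, c, hA, ha1, decAt_of_ne b (by omega), by omega, hWA, hWA'⟩
    obtain ⟨y, hy1, hy2, hy3⟩ := exists_pos_of_headSum_pos (Nat.pos_of_ne_zero hzero)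
    have hby := headSum_decAt (b := b) (t := t) hy1 (by omega) hy3
    have hby0 := headSum_decAt (b := b) (t := ℓ) hy1 (by omega) hy3
    have hby1 := headSum_decAt (b := b) (t := t - 1) hy1 hy2 hy3
    have hself := decAt_of_ne b (x := y) (z := t) (by omega)
    -- With `a x` lowered, every window is still at least `m + 1`, even with `b t` lowered too.
    -- Taking the token from `b y` instead costs a window at most one.
    have hWB : WindowsGE ℓ (decAt a x) (decAt b y) c m := by
      intro j hj1 hj2
      have hj := hWA' j hj1 hj2
      by_cases hyj : y ≤ j - 1
      · have e1 := headSum_decAt hy1 hyj hy3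
        have e2 : headSum (decAt b t) (j - 1) ≤ headSum b (j - 1) :=
          sum_le_sum fun z _ => decAt_le b t z
        omega
      · have e1 := headSum_decAt_of_lt (b := b) (x := y) (t := j - 1) (by omega)
        have e2 : headSum (decAt b t) (j - 1) ≤ headSum b (j - 1) :=
          sum_le_sum fun z _ => decAt_le b t z
        omega
    have hB : SegmentMove ℓ t a b c (decAt a x) (decAt b y) c :=
      ⟨fun z _ _ => decAt_le a x z, fun z _ _ => decAt_le b y z, le_rfl,
        fun z _ _ _ => decAt_of_ne a (by omega), fun z _ _ => decAt_of_ne b (by omega)⟩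
    obtain ⟨a', b', c', hm, e1, e2, e3, e4, e5⟩ :=
      ih (a := decAt a x) (by omega) (b := decAt b y) (by omega) (by omega) (by omega) hWB
    refine ⟨a', b', c', hB.trans hm, e1.trans ha1, e2.trans (decAt_of_ne b ?_), by omega, e4, e5⟩
    omega

/-- The mirror image of `exists_segmentMove_windows_min`. -/
theorem exists_segmentMove_windows_min_left {ℓ t c m : ℕ} (h1 : 1 ≤ t) (h2 : t ≤ ℓ)
    {a b : ℕ → ℕ} (hb1 : tailSum ℓ a t ≤ headSum b (t - 1))
    (hb2 : headSum b (t - 1) ≤ tailSum ℓ a (t - 1)) (ha : 0 < a t) (hW : WindowsGE ℓ a b c m) :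
    ∃ a' b' c', SegmentMove ℓ (t - 1) a b c a' b' c' ∧ a' 1 = a 1 ∧ b' ℓ = b ℓ ∧
      tailSum ℓ a' 0 + headSum b ℓ = tailSum ℓ a 0 + headSum b' ℓ ∧
      WindowsGE ℓ a' b' c' m ∧ ¬ WindowsGE ℓ a' b' c' (m + 1) := by
  have r1 := tailSum_reflect (ℓ := ℓ) (t := ℓ + 1 - t) b (by omega)
  have r2 := headSum_reflect (ℓ := ℓ) (t := ℓ + 1 - t) a (by omega)
  have r3 := headSum_reflect (ℓ := ℓ) (t := ℓ + 1 - t - 1) a (by omega)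
  rw [show ℓ - (ℓ + 1 - t) = t - 1 by omega] at r1 r2
  rw [show ℓ - (ℓ + 1 - t - 1) = t by omega] at r3
  obtain ⟨a', b', c', hm, e1, e2, e3, e4, e5⟩ :=
    exists_segmentMove_windows_min (ℓ := ℓ) (t := ℓ + 1 - t) (c := c) (m := m) (by omega) (by omega)
      (a := reflect ℓ b) (b := reflect ℓ a) (by omega) (by omega)
      (Or.inl (by rwa [reflect, show ℓ + 1 - (ℓ + 1 - t) = t by omega]))
      (windowsGE_reflect.2 hW)
  have hm' := hm.reflect (by omega)
  rw [show ℓ - (ℓ + 1 - t) = t - 1 by omega] at hm'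
  refine ⟨_, _, c', hm', ?_, ?_, ?_, windowsGE_reflect.2 e4, fun h => e5 (windowsGE_reflect.1 h)⟩
  · simpa [reflect] using e2
  · simpa [reflect] using e1
  · rw [tailSum_reflect _ (Nat.zero_le ℓ), headSum_reflect _ le_rfl, Nat.sub_self,
      Nat.sub_zero] at e3 ⊢
    omega

/-- Where the decreasing tail sums of `a` cross the increasing head sums of `b`. -/
theorem exists_crossing {ℓ : ℕ} (hℓ : 1 ≤ ℓ) {a b : ℕ → ℕ} (h : tailSum ℓ a 0 = headSum b ℓ) :
    ∃ t, 1 ≤ t ∧ t ≤ ℓ ∧ ((tailSum ℓ a t = 0 ∧ headSum b (t - 1) = 0) ∨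
      (headSum b (t - 1) ≤ tailSum ℓ a t ∧ tailSum ℓ a t ≤ headSum b t ∧ 0 < b t ∧
        0 < tailSum ℓ a t) ∨
      (tailSum ℓ a t ≤ headSum b (t - 1) ∧ headSum b (t - 1) ≤ tailSum ℓ a (t - 1) ∧ 0 < a t)) := by
  classical
  have hex : ∃ t, t ≤ ℓ ∧ tailSum ℓ a t ≤ headSum b t := ⟨ℓ, le_rfl, by simp [tailSum_self]⟩
  obtain ⟨h1, h2⟩ := Nat.find_spec hex
  have hmin : ∀ s, s < Nat.find hex → ¬ (s ≤ ℓ ∧ tailSum ℓ a s ≤ headSum b s) :=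
    fun s hs => Nat.find_min hex hs
  generalize Nat.find hex = t at *
  rcases Nat.eq_zero_or_pos t with rfl | ht
  · refine ⟨1, le_rfl, hℓ, Or.inl ⟨?_, headSum_zero b⟩⟩
    have := headSum_zero b
    have := tailSum_anti (ℓ := ℓ) (a := a) (Nat.zero_le 1)
    omega
  refine ⟨t, ht, h1, ?_⟩
  -- Minimality gives `headSum b (t - 1) < tailSum ℓ a (t - 1)`. This yields `0 < a t` whenever
  -- `tailSum ℓ a t ≤ headSum b (t - 1)`.
  have hm := hmin (t - 1) (by omega)
  have ea := tailSum_eq_add (ℓ := ℓ) (a := a) (t := t - 1) (by omega)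
  have eb := headSum_eq_add (b := b) ht
  rw [Nat.sub_add_cancel ht] at ea
  omega

/-! ### Moving removed tokens within the left half -/

/-- If two arrangements of the left half with the same total have their smallest window sum on
different sides of the smaller end stack, some arrangement is balanced. -/
theorem exists_balanced_between {ℓ c : ℕ} (hℓ : 1 ≤ ℓ) (a b v : ℕ → ℕ)
    (hv : ∀ x, 1 ≤ x → x ≤ ℓ → v x ≤ a x) (hvs : tailSum ℓ v 0 = headSum b ℓ)
    (hvW : ¬ WindowsGE ℓ v b c (min (v 1) (b ℓ) + 1)) :
    ∀ u : ℕ → ℕ, (∀ x, 1 ≤ x → x ≤ ℓ → u x ≤ a x) → tailSum ℓ u 0 = headSum b ℓ →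
      WindowsGE ℓ u b c (min (u 1) (b ℓ)) →
      ∃ w c', (∀ x, 1 ≤ x → x ≤ ℓ → w x ≤ a x) ∧ c' ≤ c ∧ BalancedHalves ℓ w b c' := by
  intro u
  -- The truncated differences count the tokens still to be shifted from `u` to reach `v`.
  induction hN : ∑ x ∈ Ioc 0 ℓ, (u x - v x) using Nat.strong_induction_on generalizing u with
  | _ N ih =>
  intro hu hus huW
  by_cases huW' : WindowsGE ℓ u b c (min (u 1) (b ℓ) + 1)
  swap
  · exact ⟨u, c, hu, le_rfl, hus, huW, huW'⟩
  have hsum : ∑ x ∈ Ioc 0 ℓ, u x = ∑ x ∈ Ioc 0 ℓ, v x := hus.trans hvs.symm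
  have hne : ¬ ∀ x, 1 ≤ x → x ≤ ℓ → u x = v x := fun hall => by
    apply hvW
    rw [← hall 1 le_rfl hℓ]
    exact huW'.congr (fun x h1 h2 => (hall x (by omega) h2).symm) fun _ _ _ => rfl
  obtain ⟨x, hx1, hx2, hx⟩ : ∃ x, 1 ≤ x ∧ x ≤ ℓ ∧ u x < v x := by
    by_contra! hc
    refine hne fun x h1 h2 => ((sum_eq_sum_iff_of_le fun z hz => ?_).1 hsum.symm x
      (mem_Ioc.2 ⟨h1, h2⟩)).symm
    exact hc z (mem_Ioc.1 hz).1 (mem_Ioc.1 hz).2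
  obtain ⟨y, hy1, hy2, hy⟩ : ∃ y, 1 ≤ y ∧ y ≤ ℓ ∧ v y < u y := by
    by_contra! hc
    refine hne fun x h1 h2 => (sum_eq_sum_iff_of_le fun z hz => ?_).1 hsum x
      (mem_Ioc.2 ⟨h1, h2⟩)
    exact hc z (mem_Ioc.1 hz).1 (mem_Ioc.1 hz).2
  have hxy : x ≠ y := fun h => by subst h; omega
  have hxval : decAt (incAt u x) y x = u x + 1 := by rw [decAt_of_ne _ hxy, incAt_self]
  have hyval : decAt (incAt u x) y y = u y - 1 := by rw [decAt_self, incAt_of_ne _ hxy.symm]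
  have hzval : ∀ z, z ≠ x → z ≠ y → decAt (incAt u x) y z = u z := fun z h1 h2 => by
    rw [decAt_of_ne _ h2, incAt_of_ne _ h1]
  have hypos : 0 < incAt u x y := by rw [incAt_of_ne _ hxy.symm]; omega
  have hle : ∀ z, 1 ≤ z → z ≤ ℓ → decAt (incAt u x) y z ≤ a z := fun z h1 h2 => by
    have := hu z h1 h2
    by_cases hzx : z = x
    · subst hzx
      have := hv z h1 h2
      omega
    by_cases hzy : z = y
    · subst hzy
      omega
    · rw [hzval z hzx hzy]; exact this
  have hW : ∀ t, tailSum ℓ u t ≤ tailSum ℓ (decAt (incAt u x) y) t + 1 := fun t => by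
    have h1 : tailSum ℓ u t ≤ tailSum ℓ (incAt u x) t := by
      by_cases h : t < x
      · have := tailSum_incAt (a := u) h hx2
        omega
      · rw [tailSum_incAt_of_le (by omega)]
    by_cases h : t < y
    · have := tailSum_decAt h hy2 hypos
      omega
    · have := tailSum_decAt_of_le (ℓ := ℓ) (a := incAt u x) (x := y) (t := t) (by omega)
      omega
  by_cases hnext : WindowsGE ℓ (decAt (incAt u x) y) b c
      (min (decAt (incAt u x) y 1) (b ℓ))
  · refine ih _ ?_ _ rfl hle ?_ hnext
    · rw [← hN]
      refine sum_lt_sum (fun z _ => ?_) ⟨y, mem_Ioc.2 ⟨hy1, hy2⟩, by omega⟩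
      by_cases hzx : z = x
      · subst hzx; omega
      by_cases hzy : z = y
      · subst hzy; omega
      · rw [hzval z hzx hzy]
    · have e1 := tailSum_decAt (t := 0) (by omega) hy2 hypos
      have e2 := tailSum_incAt (a := u) (t := 0) (by omega) hx2
      omega
  -- A shift lowers each window by at most one, and all windows had one to spare. So it fails only
  -- if the end minimum rises, which needs the token to arrive at stack `1`.
  have hx_one : x = 1 := by
    by_contra hx1'
    refine hnext fun t h1 h2 => ?_
    have e1 := huW' t h1 h2
    have e2 := hW t
    have e3 : decAt (incAt u x) y 1 ≤ u 1 := by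
      refine (decAt_le _ _ _).trans ?_
      rw [incAt_of_ne _ (by omega)]
    omega
  subst hx_one
  rw [hxval] at hnext
  unfold WindowsGE at hnext
  push Not at hnext
  obtain ⟨j, hj1, hj2, hj⟩ := hnext
  have hju := huW' j hj1 hj2
  have hjW := hW j
  -- Window `j` exceeds the end minimum of `u` by exactly one, and `u 1 < b ℓ`. If `c > 0`, dropping
  -- one middle token balances `u`. If `c = 0`, the token for stack `1` is taken from the first
  -- nonempty later stack `z`: windows from `z` on are unchanged, and those before `z` contain the
  -- whole left tail, which is large because the halves have equal sums.
  rcases Nat.eq_zero_or_pos c with rfl | hc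
  · have s1 := tailSum_eq_add (ℓ := ℓ) (a := u) (t := 0) (by omega)
    have s2 := headSum_eq_add (b := b) (t := ℓ) (by omega)
    rw [zero_add] at s1
    have hWℓ := huW' ℓ hℓ le_rfl
    rw [tailSum_self] at hWℓ
    obtain ⟨z, hz1, hz2, hz3, hz4⟩ := exists_first_pos (ℓ := ℓ) (a := u) (t := 1) (by omega)
    have hzpos : 0 < incAt u 1 z := by rw [incAt_of_ne _ (by omega)]; exact hz3
    have hone : decAt (incAt u 1) z 1 = u 1 + 1 := by
      rw [decAt_of_ne _ (by omega), incAt_self]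
    have hsumz : ∀ t, 1 ≤ t → t < z →
        tailSum ℓ (decAt (incAt u 1) z) t + 1 = tailSum ℓ u t := fun t h1 h2 => by
      rw [tailSum_decAt h2 hz2 hzpos, tailSum_incAt_of_le h1]
    have hsumz' : ∀ t, z ≤ t → tailSum ℓ (decAt (incAt u 1) z) t = tailSum ℓ u t := fun t h1 => by
      rw [tailSum_decAt_of_le h1, tailSum_incAt_of_le (by omega)]
    refine ⟨decAt (incAt u 1) z, 0, fun t h1 h2 => ?_, le_rfl, ?_, ?_, ?_⟩
    · by_cases ht : t = 1
      · subst ht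
        have := hv 1 h1 h2
        omega
      · refine (decAt_le _ _ _).trans ?_
        rw [incAt_of_ne _ ht]
        exact hu t h1 h2
    · have e1 := tailSum_decAt (t := 0) (by omega) hz2 hzpos
      have e2 := tailSum_incAt (a := u) (t := 0) (x := 1) (by omega) hx2
      omega
    · rw [hone]
      intro t h1 h2
      have ht := huW' t h1 h2
      by_cases htz : t < z
      · have e1 := hsumz t h1 htz
        have e2 := tailSum_eq_of_zero (ℓ := ℓ) (a := u) (s := 1) (t := t) h1 h2
          fun i hi hi' => hz4 i hi (by omega)
        omega
      · rw [hsumz' t (by omega)]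
        omega
    · rw [hone]
      intro hcon
      have e1 := hcon j hj1 hj2
      by_cases hjz : j < z
      · have := hsumz j hj1 hjz
        omega
      · rw [hsumz' j (by omega)] at e1
        omega
  · refine ⟨u, c - 1, hu, by omega, hus, fun t h1 h2 => ?_, fun hcon => ?_⟩
    · have := huW' t h1 h2
      omega
    · have := hcon j hj1 hj2
      omega

/-! ### Every position is balanced or has a move to a balanced position -/

theorem exists_move_balanced_of_le {ℓ c : ℕ} (hℓ : 1 ≤ ℓ) (a b : ℕ → ℕ)
    (hLR : headSum b ℓ ≤ tailSum ℓ a 0) :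
    ∃ a' b' c', ((∃ s ≤ ℓ, SegmentMove ℓ s a b c a' b' c') ∨ EndMove ℓ a b c a' b' c') ∧
      BalancedHalves ℓ a' b' c' := by
  obtain ⟨δ, hδ⟩ : ∃ δ, tailSum ℓ a 0 = headSum b ℓ + δ := ⟨_, (Nat.add_sub_of_le hLR).symm⟩
  have hs0 : tailSum ℓ (trimEnd ℓ a δ) 0 = headSum b ℓ := by
    rw [tailSum_trimEnd a (Nat.zero_le ℓ)]
    omega
  have htrim : ∀ s ≤ ℓ, (0 < s → 0 < tailSum ℓ a s - δ) →
      SegmentMove ℓ s a b c (trimEnd ℓ a δ) b c := fun s hs hpos =>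
    ⟨fun x h1 h2 => trimEnd_le a h1 h2, fun _ _ _ => le_rfl, le_rfl,
      fun x h1 h2 _ => trimEnd_eq h1 h2 hs (hpos (by omega)), fun _ _ _ => rfl⟩
  by_cases hW : WindowsGE ℓ (trimEnd ℓ a δ) b c (min (trimEnd ℓ a δ 1) (b ℓ))
  · obtain ⟨t, h1, h2, h | h | h⟩ := exists_crossing hℓ hs0
    · obtain ⟨hc, e1, e2⟩ := windows_min_of_sum_eq_zero h1 h2 h.1 h.2 hW
      have hm := htrim 0 (Nat.zero_le ℓ) (by omega)
      exact ⟨_, b, _, Or.inl ⟨0, Nat.zero_le ℓ, hm.left_le, hm.right_le, hc, hm.left_eq,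
        hm.right_eq⟩, hs0, e1, e2⟩
    · obtain ⟨a', b', c', hm, e1, e2, e3, e4, e5⟩ :=
        exists_segmentMove_windows_min h1 h2 h.1 h.2.1 (Or.inl h.2.2.1) hW
      -- A positive trimmed tail means that trimming stayed beyond `t`, so it merges with the paired
      -- removals into one segment move.
      have hpos := h.2.2.2
      rw [tailSum_trimEnd a h2] at hpos
      refine ⟨a', b', c', Or.inl ⟨t, h2, (htrim t h2 fun _ => hpos).trans hm⟩, by omega, ?_, ?_⟩
      · rwa [e1, e2]
      · rwa [e1, e2]
    · obtain ⟨a', b', c', hm, e1, e2, e3, e4, e5⟩ :=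
        exists_segmentMove_windows_min_left h1 h2 h.1 h.2.1 h.2.2 hW
      have hpos : 0 < tailSum ℓ (trimEnd ℓ a δ) (t - 1) := by
        rw [tailSum_eq_add (by omega), Nat.sub_add_cancel h1]
        omega
      rw [tailSum_trimEnd a (by omega)] at hpos
      refine ⟨a', b', c', Or.inl ⟨t - 1, by omega, (htrim _ (by omega) fun _ => hpos).trans hm⟩,
        by omega, ?_, ?_⟩
      · rwa [e1, e2]
      · rwa [e1, e2]
  have ha0 := tailSum_eq_add (ℓ := ℓ) (a := a) (t := 0) (by omega)
  rw [zero_add] at ha0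
  -- The opposite extreme to `trimEnd ℓ a δ`: stack `1` pays first, and truncated subtraction leaves
  -- only the excess `δ - a 1` to the other stacks.
  set u : ℕ → ℕ := Function.update (trimEnd ℓ a (δ - a 1)) 1 (a 1 - δ) with hu
  have hu1 : u 1 = a 1 - δ := by simp [hu]
  have hu2 : ∀ x, 2 ≤ x → u x = trimEnd ℓ a (δ - a 1) x := fun x hx => by
    rw [hu, Function.update_of_ne (by omega)]
  have hule : ∀ x, 1 ≤ x → x ≤ ℓ → u x ≤ a x := fun x h1 h2 => by
    by_cases hx : x = 1
    · subst hx; omega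
    · rw [hu2 x (by omega)]
      exact trimEnd_le a h1 h2
  have hus1 : tailSum ℓ u 1 = tailSum ℓ a 1 - (δ - a 1) := by
    rw [tailSum_congr fun x h1 _ => hu2 x h1, tailSum_trimEnd a hℓ]
  have hus : tailSum ℓ u 0 = headSum b ℓ := by
    rw [tailSum_eq_add (by omega), zero_add, hu1, hus1]
    omega
  by_cases huW : WindowsGE ℓ u b c (min (u 1) (b ℓ))
  · obtain ⟨w, c', hw, hc, hbal⟩ := exists_balanced_between hℓ a b (trimEnd ℓ a δ)
      (fun x h1 h2 => trimEnd_le a h1 h2) hs0 (fun h => hW (h.mono (Nat.le_succ _))) u hule hus huW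
    exact ⟨w, b, c', Or.inl ⟨0, Nat.zero_le ℓ, hw, fun _ _ _ => le_rfl, hc,
      fun x h1 h2 _ => by omega, fun _ _ _ => rfl⟩, hbal⟩
  obtain ⟨m, hm1, hm2⟩ := exists_window_min hℓ u b c
  have hm : m < min (u 1) (b ℓ) := by
    by_contra! hc
    exact huW (hm1.mono hc)
  -- Since `m < u 1`, stack `1` is not exhausted, so `δ < a 1` and nothing else was removed.
  have hua : ∀ x, 2 ≤ x → x ≤ ℓ → u x = a x := fun x h1 h2 => by
    refine le_antisymm (hule x (by omega) h2) ?_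
    have e := tailSum_eq_add (ℓ := ℓ) (t := x - 1) (a := a) (by omega)
    rw [Nat.sub_add_cancel (by omega)] at e
    rw [hu2 x h1, trimEnd]
    omega
  -- Lowering both ends by `e` keeps the halves equal and brings the end minimum down to the least
  -- window sum `m`.
  set e := min (u 1) (b ℓ) - m with he
  have hA1 : Function.update u 1 (u 1 - e) 1 = u 1 - e := by simp
  have hA2 : ∀ x, 2 ≤ x → x ≤ ℓ → Function.update u 1 (u 1 - e) x = u x := fun x h1 _ =>
    Function.update_of_ne (by omega) _ _
  have hB1 : Function.update b ℓ (b ℓ - e) ℓ = b ℓ - e := by simp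
  have hB2 : ∀ y, 1 ≤ y → y < ℓ → Function.update b ℓ (b ℓ - e) y = b y := fun y _ h2 =>
    Function.update_of_ne (by omega) _ _
  have hmin : min (u 1 - e) (b ℓ - e) = m := by omega
  refine ⟨Function.update u 1 (u 1 - e), Function.update b ℓ (b ℓ - e), c,
    Or.inr ⟨by omega, by omega, rfl, fun x h1 h2 => (hA2 x h1 h2).trans (hua x h1 h2), hB2⟩,
    ?_, ?_, ?_⟩
  · have e1 := headSum_eq_add (b := b) (t := ℓ) (by omega)
    have e2 := tailSum_eq_add (ℓ := ℓ) (a := u) (t := 0) (by omega)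
    rw [zero_add] at e2
    rw [tailSum_eq_add (by omega), headSum_eq_add (by omega), zero_add, hA1, hB1,
      tailSum_congr fun x h1 h2 => hA2 x h1 h2, headSum_congr fun y h1 h2 => hB2 y h1 (by omega)]
    omega
  · rw [hA1, hB1, hmin]
    exact hm1.congr hA2 hB2
  · rw [hA1, hB1, hmin]
    exact fun h => hm2 (h.congr (fun x h1 h2 => (hA2 x h1 h2).symm)
      fun y h1 h2 => (hB2 y h1 h2).symm)

theorem exists_move_balanced {ℓ : ℕ} (hℓ : 1 ≤ ℓ) (a b : ℕ → ℕ) (c : ℕ) :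
    ∃ a' b' c', ((∃ s ≤ ℓ, SegmentMove ℓ s a b c a' b' c') ∨ EndMove ℓ a b c a' b' c') ∧
      BalancedHalves ℓ a' b' c' := by
  rcases le_total (headSum b ℓ) (tailSum ℓ a 0) with h | h
  · exact exists_move_balanced_of_le hℓ a b h
  · obtain ⟨a', b', c', hm, hb⟩ := exists_move_balanced_of_le (c := c) hℓ (reflect ℓ b)
      (reflect ℓ a) (by
        rwa [tailSum_reflect _ (Nat.zero_le ℓ), headSum_reflect _ le_rfl, Nat.sub_self,
          Nat.sub_zero])
    refine ⟨_, _, c', ?_, hb.reflect⟩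
    rcases hm with ⟨s, hs, hm⟩ | hm
    · exact Or.inl ⟨ℓ - s, by omega, hm.reflect hs⟩
    · exact Or.inr hm.reflect

theorem BalancedHalves.congr {ℓ c : ℕ} (hℓ : 1 ≤ ℓ) {a b a' b' : ℕ → ℕ}
    (h : BalancedHalves ℓ a b c) (ha : ∀ x, 1 ≤ x → x ≤ ℓ → a' x = a x)
    (hb : ∀ y, 1 ≤ y → y ≤ ℓ → b' y = b y) : BalancedHalves ℓ a' b' c where
  sum_eq := by
    rw [tailSum_congr fun x h1 h2 => ha x h1 h2, headSum_congr fun y h1 h2 => hb y h1 h2]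
    exact h.sum_eq
  ge := by
    rw [ha 1 le_rfl hℓ, hb ℓ hℓ le_rfl]
    exact h.ge.congr (fun x h1 h2 => ha x (by omega) h2) fun y h1 h2 => hb y h1 h2.le
  not_ge := by
    rw [ha 1 le_rfl hℓ, hb ℓ hℓ le_rfl]
    exact fun hc => h.not_ge (hc.congr (fun x h1 h2 => (ha x (by omega) h2).symm)
      fun y h1 h2 => (hb y h1 h2.le).symm)

/-! ### Positions on the path -/

/-- The number of tokens on the vertex with label `x`, and `0` if there is no such vertex. -/
def stackAt {n : ℕ} (p : Position n) (x : ℕ) : ℕ :=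
  if h : 1 ≤ x ∧ x ≤ n then p ⟨x - 1, by omega⟩ else 0

/-- The position is balanced when it is cut into its first `ℓ` stacks, the stacks with labels in
`(ℓ, k]`, and the stacks with labels greater than `k`. -/
def IsBalanced {n : ℕ} (ℓ k : ℕ) (p : Position n) : Prop :=
  BalancedHalves ℓ (stackAt p) (fun y => stackAt p (k + y)) (∑ x ∈ Ioc ℓ k, stackAt p x)

theorem stackAt_succ {n : ℕ} (p : Position n) (v : Fin n) : stackAt p (v + 1) = p v := by
  have := v.2
  simp [stackAt, show (v : ℕ) + 1 ≤ n by omega]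

theorem segmentSum_eq_sum_stackAt {n i j : ℕ} (p : Position n) (hj : j ≤ n) :
    segmentSum p (i + 1) j = ∑ x ∈ Ioc i j, stackAt p x := by
  unfold segmentSum pathSegment
  refine sum_bij (fun v _ => (v : ℕ) + 1) ?_ ?_ ?_ ?_
  · intro v hv
    simp only [mem_filter, mem_univ, true_and] at hv
    exact mem_Ioc.2 ⟨by omega, by omega⟩
  · intro v _ w _ h
    exact Fin.ext (by omega)
  · intro x hx
    have := mem_Ioc.1 hx
    refine ⟨⟨x - 1, by omega⟩, ?_, by simp only; omega⟩
    simp only [mem_filter, mem_univ, true_and]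
    omega
  · intro v _
    exact (stackAt_succ p v).symm

theorem stackAt_le_stackAt {n : ℕ} {p q : Position n} (h : ∀ v, q v ≤ p v) (x : ℕ) :
    stackAt q x ≤ stackAt p x := by
  unfold stackAt
  split_ifs
  · exact h _
  · exact le_rfl

theorem eq_of_stackAt_eq {n : ℕ} {p q : Position n}
    (h : ∀ x, 1 ≤ x → x ≤ n → stackAt q x = stackAt p x) : q = p := by
  funext v
  rw [← stackAt_succ q v, ← stackAt_succ p v]
  exact h _ (by omega) (by omega)

theorem headSum_shift {n : ℕ} (p : Position n) (k t : ℕ) :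
    headSum (fun y => stackAt p (k + y)) t = ∑ x ∈ Ioc k (k + t), stackAt p x := by
  unfold headSum
  refine sum_nbij' (fun y => k + y) (fun x => x - k) ?_ ?_ ?_ ?_ ?_ <;>
    intro x hx <;> simp only [mem_Ioc] at hx ⊢ <;> omega

theorem isBalanced_iff {n k ℓ : ℕ} (hn : 3 ≤ n) (hℓ : ℓ = n / 2) (hk : k = (n + 1) / 2)
    (p : Position n) :
    IsBalanced ℓ k p ↔ segmentSum p 1 ℓ = segmentSum p (k + 1) n ∧
        min (firstStack hn p) (lastStack hn p) =
          (Finset.Icc 2 (ℓ + 1)).inf' (windowIndices_nonempty hn hℓ)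
            (fun i => segmentSum p i (i + k - 2)) := by
  have hfirst : firstStack hn p = stackAt p 1 := by
    simp [firstStack, stackAt, show 1 ≤ n by omega]
  have hlast : lastStack hn p = stackAt p (k + ℓ) := by
    simp [lastStack, stackAt, show k + ℓ = n by omega, show 1 ≤ n by omega]
  have hleft : segmentSum p 1 ℓ = tailSum ℓ (stackAt p) 0 :=
    segmentSum_eq_sum_stackAt p (by omega)
  have hright : segmentSum p (k + 1) n = headSum (fun y => stackAt p (k + y)) ℓ := by
    rw [segmentSum_eq_sum_stackAt p le_rfl, headSum_shift, show k + ℓ = n by omega]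
  have hwin : ∀ m, m ≤ (Finset.Icc 2 (ℓ + 1)).inf' (windowIndices_nonempty hn hℓ)
      (fun i => segmentSum p i (i + k - 2)) ↔ WindowsGE ℓ (stackAt p)
        (fun y => stackAt p (k + y)) (∑ x ∈ Ioc ℓ k, stackAt p x) m := fun m => by
    have key : ∀ t, 1 ≤ t → t ≤ ℓ → segmentSum p (t + 1) (t + 1 + k - 2) =
        ∑ x ∈ Ioc ℓ k, stackAt p x + tailSum ℓ (stackAt p) t +
          headSum (fun y => stackAt p (k + y)) (t - 1) := fun t h1 h2 => by
      rw [segmentSum_eq_sum_stackAt p (by omega), headSum_shift,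
        show t + 1 + k - 2 = k + (t - 1) by omega,
        ← sum_Ioc_consecutive _ (show t ≤ k by omega) (show k ≤ k + (t - 1) by omega),
        ← sum_Ioc_consecutive _ h2 (show ℓ ≤ k by omega), tailSum]
      omega
    rw [le_inf'_iff]
    constructor
    · intro h t h1 h2
      rw [← key t h1 h2]
      exact h (t + 1) (mem_Icc.2 ⟨by omega, by omega⟩)
    · intro h i hi
      have := mem_Icc.1 hi
      obtain ⟨t, rfl⟩ : ∃ t, i = t + 1 := ⟨i - 1, by omega⟩
      rw [key t (by omega) (by omega)]
      exact h t (by omega) (by omega)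
  rw [hfirst, hlast, hleft, hright]
  constructor
  · rintro ⟨h1, h2, h3⟩
    rw [← hwin] at h2 h3
    exact ⟨h1, by omega⟩
  · rintro ⟨h1, h2⟩
    refine ⟨h1, ?_, ?_⟩
    · rw [← hwin]; exact h2.le
    · rw [← hwin]; exact fun h => by rw [h2] at h; omega

/-! ### Legal moves on the path versus moves on halves -/

theorem not_isBalanced_of_move {n k ℓ : ℕ} (hn : 3 ≤ n) (hℓ : ℓ = n / 2) (hk : k = (n + 1) / 2)
    {p q : Position n} (hp : IsBalanced ℓ k p) (h : SetNimMove (necklaceNim n k) p q) :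
    ¬ IsBalanced ℓ k q := by
  intro hq
  obtain ⟨A, hA, hle, heq, v, hv⟩ := h
  have hle' := stackAt_le_stackAt hle
  have hoff : ∀ x, (∀ w : Fin n, (w : ℕ) + 1 = x → w ∉ A) → stackAt q x = stackAt p x :=
    fun x hx => by
      unfold stackAt
      split_ifs with h1
      · exact heq _ (hx _ (by simp only; omega))
      · rfl
  suffices q = p by rw [this] at hv; exact lt_irrefl _ hv
  rcases hA with ⟨i, hi1, hi2, rfl⟩ | hA
  · have hoff' : ∀ x, x < i ∨ i + k - 1 < x → stackAt q x = stackAt p x := fun x hx =>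
      hoff x fun w hw => by
        simp only [pathSegment, mem_filter, mem_univ, true_and]
        omega
    have hm : SegmentMove ℓ (i - 1) (stackAt p) (fun y => stackAt p (k + y))
        (∑ x ∈ Ioc ℓ k, stackAt p x) (stackAt q) (fun y => stackAt q (k + y))
        (∑ x ∈ Ioc ℓ k, stackAt q x) :=
      ⟨fun x _ _ => hle' x, fun y _ _ => hle' _, sum_le_sum fun x _ => hle' x,
        fun x _ h2 _ => hoff' x (by omega), fun y h1 _ => hoff' _ (by omega)⟩
    obtain ⟨h1, h2, h3⟩ := hp.eq_of_segmentMove (by omega) (by omega) hq hm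
    refine eq_of_stackAt_eq fun x hx1 hx2 => ?_
    by_cases hxℓ : x ≤ ℓ
    · exact h1 x hx1 hxℓ
    by_cases hxk : x ≤ k
    · exact (sum_eq_sum_iff_of_le fun z _ => hle' z).1 h3 x (mem_Ioc.2 ⟨by omega, hxk⟩)
    · have := h2 (x - k) (by omega) (by omega)
      simpa only [show k + (x - k) = x by omega] using this
  · rw [Set.mem_singleton_iff] at hA
    subst hA
    have hoff' : ∀ x, x ≠ 1 → x ≠ n → stackAt q x = stackAt p x := fun x hx hx' =>
      hoff x fun w hw => by
        simp only [endVertices, mem_filter, mem_univ, true_and]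
        omega
    have hm : EndMove ℓ (stackAt p) (fun y => stackAt p (k + y))
        (∑ x ∈ Ioc ℓ k, stackAt p x) (stackAt q) (fun y => stackAt q (k + y))
        (∑ x ∈ Ioc ℓ k, stackAt q x) := by
      refine ⟨hle' _, hle' _, sum_congr rfl fun x hx => ?_, fun x _ _ => hoff' x (by omega) (by omega),
        fun y _ _ => hoff' _ (by omega) (by omega)⟩
      have := mem_Ioc.1 hx
      exact hoff' x (by omega) (by omega)
    obtain ⟨h1, h2⟩ := hp.eq_of_endMove (by omega) hq hm
    refine eq_of_stackAt_eq fun x hx1 hx2 => ?_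
    by_cases hx : x = 1
    · rw [hx]; exact h1
    by_cases hxn : x = n
    · rw [show x = k + ℓ by omega]; exact h2
    · exact hoff' x hx hxn

/-- The position with given left half, middle stack and right half. -/
def ofHalves (n ℓ k : ℕ) (a b : ℕ → ℕ) (c : ℕ) : Position n := fun v =>
  if (v : ℕ) + 1 ≤ ℓ then a (v + 1) else if (v : ℕ) + 1 ≤ k then c else b (v + 1 - k)

theorem exists_isBalanced_eq_or_move {n k ℓ : ℕ} (hn : 3 ≤ n) (hℓ : ℓ = n / 2)
    (hk : k = (n + 1) / 2) (p : Position n) :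
    ∃ q, IsBalanced ℓ k q ∧ (q = p ∨ SetNimMove (necklaceNim n k) p q) := by
  obtain ⟨a, b, c, hm, hbal⟩ := exists_move_balanced (ℓ := ℓ) (by omega) (stackAt p)
    (fun y => stackAt p (k + y)) (∑ x ∈ Ioc ℓ k, stackAt p x)
  set q := ofHalves n ℓ k a b c with hq
  have hqa : ∀ x, 1 ≤ x → x ≤ ℓ → stackAt q x = a x := fun x h1 h2 => by
    rw [stackAt, dif_pos (by omega), hq]
    simp only [ofHalves]
    rw [if_pos (by omega), Nat.sub_add_cancel h1]
  have hqc : ∀ x, ℓ < x → x ≤ k → stackAt q x = c := fun x h1 h2 => by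
    rw [stackAt, dif_pos (by omega), hq]
    simp only [ofHalves]
    rw [if_neg (by omega), if_pos (by omega)]
  have hqb : ∀ y, 1 ≤ y → y ≤ ℓ → stackAt q (k + y) = b y := fun y h1 h2 => by
    rw [stackAt, dif_pos (by omega), hq]
    simp only [ofHalves]
    rw [if_neg (by omega), if_neg (by omega)]
    congr 1
    omega
  have hc_le : c ≤ ∑ x ∈ Ioc ℓ k, stackAt p x := by
    rcases hm with ⟨s, _, hm⟩ | hm
    · exact hm.mid_le
    · exact hm.mid_eq.le
  have hmid : ∀ r : Position n, (k = ℓ ∧ ∑ x ∈ Ioc ℓ k, stackAt r x = 0) ∨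
      (k = ℓ + 1 ∧ ∑ x ∈ Ioc ℓ k, stackAt r x = stackAt r k) := fun r => by
    rcases (by omega : k = ℓ ∨ k = ℓ + 1) with h | h
    · exact Or.inl ⟨h, by simp [h]⟩
    · exact Or.inr ⟨h, by simp [h]⟩
  -- For even `n` there is no middle stack to hold `c`; then `c` is zero because moves do not
  -- increase the middle.
  have hqsum : ∑ x ∈ Ioc ℓ k, stackAt q x = c := by
    rcases hmid q with ⟨h, h'⟩ | ⟨h, h'⟩
    · have := hmid p
      omega
    · rw [h', hqc k (by omega) le_rfl]
  have hqbal : IsBalanced ℓ k q := by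
    unfold IsBalanced
    rw [hqsum]
    exact hbal.congr (by omega) hqa hqb
  refine ⟨q, hqbal, ?_⟩
  by_cases hqp : q = p
  · exact Or.inl hqp
  right
  have hmove : ∀ A ∈ necklaceNim n k, (∀ x, 1 ≤ x → x ≤ n → stackAt q x ≤ stackAt p x) →
      (∀ v : Fin n, v ∉ A → stackAt q (v + 1) = stackAt p (v + 1)) →
      SetNimMove (necklaceNim n k) p q := fun A hA hle heq => by
    have hle' : ∀ v, q v ≤ p v := fun v => by
      have := hle (v + 1) (by omega) (by omega)
      rwa [stackAt_succ, stackAt_succ] at this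
    refine ⟨A, hA, hle', fun v hv => ?_, ?_⟩
    · rw [← stackAt_succ q v, heq v hv, stackAt_succ]
    · by_contra! hc
      exact hqp (funext fun v => le_antisymm (hle' v) (hc v))
  have hcases : ∀ (P : ℕ → Prop), (∀ x, 1 ≤ x → x ≤ ℓ → P x) → (k = ℓ + 1 → P k) →
      (∀ y, 1 ≤ y → y ≤ ℓ → P (k + y)) → ∀ x, 1 ≤ x → x ≤ n → P x := by
    intro P h1 h2 h3 x hx1 hx2
    by_cases hxℓ : x ≤ ℓ
    · exact h1 x hx1 hxℓ
    by_cases hxk : x ≤ k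
    · obtain rfl : x = k := by omega
      exact h2 (by omega)
    · have := h3 (x - k) (by omega) (by omega)
      rwa [show k + (x - k) = x by omega] at this
  rcases hm with ⟨s, hs, hm⟩ | hm
  · refine hmove (pathSegment n (s + 1) (s + 1 + k - 1))
      (Or.inl ⟨s + 1, by omega, by omega, rfl⟩) ?_ fun v hv => ?_
    · refine hcases _ (fun x h1 h2 => ?_) (fun h => ?_) fun y h1 h2 => ?_
      · rw [hqa x h1 h2]; exact hm.left_le x h1 h2
      · rw [hqc k (by omega) le_rfl]
        have := hmid p
        omega
      · rw [hqb y h1 h2]; exact hm.right_le y h1 h2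
    · simp only [pathSegment, mem_filter, mem_univ, true_and] at hv
      revert hv
      refine hcases (fun x => ¬ (s + 1 ≤ x ∧ x ≤ s + 1 + k - 1) → stackAt q x = stackAt p x)
        (fun x h1 h2 hv => ?_) (fun h hv => ?_) (fun y h1 h2 hv => ?_) (v + 1) (by omega) (by omega)
      · rw [hqa x h1 h2]
        exact hm.left_eq x h1 (by omega) h2
      · omega
      · rw [hqb y h1 h2]
        exact hm.right_eq y (by omega) h2
  · have hends : ∀ x, 1 ≤ x → x ≤ n → ¬ (x = 1 ∨ x = n) → stackAt q x = stackAt p x := by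
      refine hcases _ (fun x h1 h2 hv => ?_) (fun h hv => ?_) fun y h1 h2 hv => ?_
      · rw [hqa x h1 h2]
        exact hm.left_eq x (by omega) h2
      · rw [hqc k (by omega) le_rfl]
        have := hmid p
        have := hm.mid_eq
        omega
      · rw [hqb y h1 h2]
        exact hm.right_eq y h1 (by omega)
    refine hmove (endVertices n) (Or.inr rfl) (fun x h1 h2 => ?_) fun v hv => ?_
    · by_cases hx1 : x = 1
      · rw [hx1, hqa 1 le_rfl (by omega)]
        exact hm.left_le
      by_cases hx2 : x = n
      · rw [show x = k + ℓ by omega, hqb ℓ (by omega) le_rfl]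
        exact hm.right_le
      · exact (hends x h1 h2 (by omega)).le
    · simp only [endVertices, mem_filter, mem_univ, true_and] at hv
      exact hends (v + 1) (by omega) (by omega) hv

/-- Induction on the number of tokens: balanced positions have no balanced option, and every other
position has one. -/
theorem isPPosition_iff_isBalanced {n k ℓ : ℕ} (hn : 3 ≤ n) (hℓ : ℓ = n / 2)
    (hk : k = (n + 1) / 2) (p : Position n) :
    IsPPosition (necklaceNim n k) p ↔ IsBalanced ℓ k p := by
  induction hN : ∑ v, p v using Nat.strong_induction_on generalizing p with
  | _ N ih =>
  rw [IsPPosition]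
  constructor
  · intro h
    obtain ⟨q, hq, rfl | hmove⟩ := exists_isBalanced_eq_or_move hn hℓ hk p
    · exact hq
    · exact absurd ((ih _ (hN ▸ hmove.sum_lt) q rfl).2 hq) (h q hmove)
  · intro hp q hmove hq
    exact not_isBalanced_of_move hn hℓ hk hp hmove ((ih _ (hN ▸ hmove.sum_lt) q rfl).1 hq)

/-- Here `n / 2` and `(n + 1) / 2` are quotients of natural numbers, that is, the floor and the
ceiling of half of `n`. -/
theorem mainTheorem3 (n k ℓ : ℕ) (hn : 3 ≤ n) (hℓ : ℓ = n / 2) (hk : k = (n + 1) / 2) :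
    {p : Position n | IsPPosition (necklaceNim n k) p} =
      {p : Position n |
        segmentSum p 1 ℓ = segmentSum p (k + 1) n ∧
        min (firstStack hn p) (lastStack hn p) =
          (Finset.Icc 2 (ℓ + 1)).inf' (windowIndices_nonempty hn hℓ)
            (fun i => segmentSum p i (i + k - 2))} := by
  ext p
  exact (isPPosition_iff_isBalanced hn hℓ hk p).trans (isBalanced_iff hn hℓ hk p)
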